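/- Let $\mathcal A$ be a finite set with the discrete topology, let $X\subseteq\mathcal A^{\mathbb Z}$ be closed and invariant under the left shift $(\sigma x)(n)=x(n+1)$, i.e. $\sigma(X)=X$, and let $P_X(n)$ be the number of words $(a_0,\dots,a_{n-1})\in\mathcal A^n$ for which some $x\in X$ satisfies $x(i)=a_i$ for $0\le i<n$. Let $\mathrm{Aut}(X)$ be the group of homeomorphisms of $X$ commuting with $\sigma$ and, for $R\in\mathbb N\cup\{0\}$, let $\mathrm{Aut}_R(X)$ be the set of $\varphi\in\mathrm{Aut}(X)$ such that $(\varphi x)(0)=(\varphi y)(0)$ whenever $x,y\in X$ satisfy $x(n)=y(n)$ for all $-R\le n\le R$. Write $\mathcal O(x)=\{\sigma^n x : n\in\mathbb Z\}$. A point $x$ is aperiodic if $\sigma^n x\ne x$ for all $n\ge 1$. We say that a finitely generated group $G$ has polynomial growth with rate at most $d$ if for every finite generating set $S$ there is a constant $C_S$ such that for all $n\ge 1$ at most $C_S\,n^d$ elements of $G$ are products of at most $n$ elements of $S\cup S^{-1}$. Proposition. Suppose that the aperiodic points are dense in $X$ and that $k\in\mathbb N$ satisfies $$\limsup_{n\to\infty}\frac{P_X(n)}{n}<k.$$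 Then every finitely generated subgroup of $\mathrm{Aut}(X)$ has polynomial growth with rate at most $k-1$. Moreover, there are finitely many points of $X$ the union of whose orbits is dense in $X$, and if $q$ is the smallest cardinality of a set of such points, then 1. $q\le k-1$; 2. every finitely generated subgroup of $\mathrm{Aut}(X)$ has polynomial growth with rate at most $q$; 3. there is a constant $C$, depending only on $X$, such that for all integers $R\ge 0$ $$\bigl|\{\varphi\in\mathrm{Aut}(X) : \varphi\in\mathrm{Aut}_R(X)\text{ and }\varphi^{-1}\in\mathrm{Aut}_R(X)\}\bigr|\le C\,(R+1)^q .$$ -/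

import Mathlib

open Filter
open scoped ENNReal

namespace ShiftSystem

open SymbolicDynamics.FullShift

/-- The left shift `(σ x)(n) = x (n + 1)`, as a homeomorphism of the subshift `X`. -/
def sigma {A : Type*} [TopologicalSpace A] (X : Subshift A ℤ) : X.carrier ≃ₜ X.carrier where
  toFun x := ⟨shift 1 x.1, X.mapsTo 1 x.2⟩
  invFun x := ⟨shift (-1) x.1, X.mapsTo (-1) x.2⟩
  left_inv x := by
    ext n
    simp [shift]
  right_inv x := by
    ext n
    simp [shift]
  continuous_toFun := by fun_prop
  continuous_invFun := by fun_prop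

/-- The (two-sided) orbit of a point under the shift. -/
def orbit {A : Type*} [TopologicalSpace A] {X : Subshift A ℤ} (x : X.carrier) :
    Set X.carrier :=
  Set.range fun n : ℤ => (sigma X ^ n) x

/-- A point is aperiodic if `σ ^ n x ≠ x` for all `n ≥ 1`. -/
def IsAperiodic {A : Type*} [TopologicalSpace A] {X : Subshift A ℤ} (x : X.carrier) : Prop :=
  ∀ n : ℕ, 0 < n → (sigma X ^ n) x ≠ x

/-- The words `w = (a_0, …, a_{n-1})` of length `n` for which some `x ∈ X` satisfies
`x i = a_i` for all `0 ≤ i < n`. -/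
def words {A : Type*} [TopologicalSpace A] (X : Subshift A ℤ) (n : ℕ) : Set (Fin n → A) :=
  {w | ∃ x ∈ X.carrier, ∀ i : Fin n, x ((i : ℕ) : ℤ) = w i}

/-- The factor complexity function `P_X`. It is only used for finite alphabets, so that
`words X n` is a finite set. -/
noncomputable def complexity {A : Type*} [TopologicalSpace A] (X : Subshift A ℤ) (n : ℕ) : ℕ :=
  (words X n).ncard

/-- The automorphism group: the centralizer of the shift in the group of all
self-homeomorphisms of `X`. -/
def Aut {A : Type*} [TopologicalSpace A] (X : Subshift A ℤ) :
    Subgroup (X.carrier ≃ₜ X.carrier) :=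
  Subgroup.centralizer {sigma X}

/-- `Aut_R(X)`: the automorphisms for which `R` is a (not necessarily minimal) range, meaning
that `(φ x)(0)` depends only on the values of `x` at `-R, …, R`. -/
def autRange {A : Type*} [TopologicalSpace A] (X : Subshift A ℤ) (R : ℕ) : Set (Aut X) :=
  {φ | ∀ x y : X.carrier, (∀ n : ℤ, -(R : ℤ) ≤ n → n ≤ (R : ℤ) → x.1 n = y.1 n) →
    (φ.1 x).1 0 = (φ.1 y).1 0}

/-- The set of the numbers `m` for which there are `m` points of `X` such that the union of
their orbits is dense in `X`. -/
def denseOrbitCounts {A : Type*} [TopologicalSpace A] (X : Subshift A ℤ) : Set ℕ :=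
  {m | ∃ s : Finset X.carrier, s.card = m ∧ Dense (⋃ x ∈ s, orbit x)}

/-- The elements of `G` that are products of at most `n` factors, each of which is an element of
`S` or the inverse of an element of `S`. -/
def wordBall {G : Type*} [Group G] (S : Finset G) (n : ℕ) : Set G :=
  {g | ∃ l : List G, l.length ≤ n ∧ (∀ a ∈ l, a ∈ S ∨ a⁻¹ ∈ S) ∧ l.prod = g}

/-- `G` is a finitely generated group of polynomial growth with rate at most `d`: for every finite
generating set `S`, the ball of radius `n` has at most `C n ^ d` elements for all `n ≥ 1`,
where `C` does not depend on `n`. -/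
def HasPolynomialGrowthAtMost (G : Type*) [Group G] (d : ℕ) : Prop :=
  Group.FG G ∧ ∀ S : Finset G, Subgroup.closure (S : Set G) = ⊤ →
    ∃ C : ℕ, ∀ n : ℕ, 1 ≤ n → (wordBall S n).encard ≤ ((C * n ^ d : ℕ) : ℕ∞)

end ShiftSystem

namespace ShiftSystem

/-! ### Finite sets -/

/-! An automorphism is determined by its values at points `x₁, …, x_q` whose orbits have dense union
(`Aut.eq_of_dense`). So it suffices that each `x` has `O(R + 1)` images under automorphisms that
have range `R` together with their inverses (`exists_encard_images_le`); the product over the `xᵢ`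
bounds the ball by `C (R + 1) ^ q`. A product of `n` generators of range `R` has range `n R`, which
yields the growth of finitely generated subgroups.

The images of `x` are counted in three cases. If `x` is periodic, its images share its period. If
`x` is isolated and not periodic, its images are isolated, hence lie in the finitely many dense
orbits, and two images in one orbit differ by a translation of at most `2R`, since a longer one
would force a period. If `x` is not isolated, some `z ≠ x` agrees with `x` on a long central
interval. For each `φ`, the points `φ x` and `φ z` agree there up to a margin `R`, but must differ
within `R` of the place where `z` and `x` part. So `φ x` carries a left special word (after a
reflection if needed) that is long enough to determine `φ x`. The left special words of lengths `m,
…, m + 2R` number at most `P(m + 2R + 1) - P(m)`, which is `O(R + 1)` for a suitable `m` because `P`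
grows linearly.

For `q < k`: if fewer than `k` orbits never had dense union, `k` aperiodic points could be picked
successively, each containing a word absent from the earlier ones. Each contributes at least `n -
O(1)` new words of length `n`, so `P(n) ≥ k n - O(1)`, against the limsup. -/

theorem ncard_add_ncard_le_of_fibers {α β : Type*} {S : Set α} {T U : Set β} (f : α → β)
    (hS : S.Finite) (hT : ∀ t ∈ T, ∃ a, a ∈ S ∧ f a = t)
    (hU : ∀ t ∈ U, ∃ a ∈ S, ∃ b ∈ S, a ≠ b ∧ f a = t ∧ f b = t) :
    T.ncard + U.ncard ≤ S.ncard := by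
  rcases isEmpty_or_nonempty α with hα | hα
  · have hT' : T = ∅ := Set.eq_empty_of_forall_notMem fun t ht => hα.elim (hT t ht).choose
    have hU' : U = ∅ := Set.eq_empty_of_forall_notMem fun t ht => hα.elim (hU t ht).choose
    simp [hT', hU']
  · choose! g hgS hg using hT
    have hU' : ∀ t ∈ U, ∃ b, b ∈ S ∧ f b = t ∧ b ≠ g t := by
      intro t ht
      obtain ⟨a, ha, b, hb, hab, hfa, hfb⟩ := hU t ht
      by_cases h : a = g t
      · exact ⟨b, hb, hfb, fun h' => hab (h.trans h'.symm)⟩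
      · exact ⟨a, ha, hfa, h⟩
    choose! h hhS hh hne using hU'
    have hg_inj : Set.InjOn g T := fun a ha b hb hab => by rw [← hg a ha, hab, hg b hb]
    have hh_inj : Set.InjOn h U := fun a ha b hb hab => by rw [← hh a ha, hab, hh b hb]
    have hgT : g '' T ⊆ S := Set.image_subset_iff.2 hgS
    have hhU : h '' U ⊆ S := Set.image_subset_iff.2 hhS
    have hdisj : Disjoint (g '' T) (h '' U) := by
      rw [Set.disjoint_left]
      rintro _ ⟨t, ht, rfl⟩ ⟨u, hu, hut⟩
      have : u = t := by rw [← hh u hu, hut, hg t ht]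
      exact hne u hu (this ▸ hut)
    rw [← hg_inj.ncard_image, ← hh_inj.ncard_image,
      ← Set.ncard_union_eq hdisj (hS.subset hgT) (hS.subset hhU)]
    exact Set.ncard_le_ncard (Set.union_subset hgT hhU) hS

theorem mapsTo_and_injOn_of_ncard_le {α β : Type*} {S : Set α} {T : Set β} (f : α → β)
    (hS : S.Finite) (hT : T ⊆ f '' S) (h : S.ncard ≤ T.ncard) :
    Set.MapsTo f S T ∧ Set.InjOn f S := by
  have h1 : (f '' S).ncard ≤ S.ncard := Set.ncard_image_le hS
  have h2 : T = f '' S := Set.eq_of_subset_of_ncard_le hT (h1.trans h) (hS.image f)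
  refine ⟨fun a ha => h2 ▸ Set.mem_image_of_mem f ha, ?_⟩
  exact Set.injOn_of_ncard_image_eq (le_antisymm h1 (h2 ▸ h)) hS

/-! ### Words of a set of two-sided sequences -/

variable {A : Type*}

/-- The word `x p, …, x (p + n - 1)`. -/
def win (n : ℕ) (x : ℤ → A) (p : ℤ) : Fin n → A := fun i => x (p + (i : ℕ))

theorem win_eq_iff {n : ℕ} {x y : ℤ → A} {p q : ℤ} :
    win n x p = win n y q ↔ ∀ i : ℕ, i < n → x (p + i) = y (q + i) :=
  ⟨fun h i hi => congrFun h ⟨i, hi⟩, fun h => funext fun i => h i i.2⟩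

theorem win_eq_iff_int {n : ℕ} {x y : ℤ → A} {p q : ℤ} :
    win n x p = win n y q ↔ ∀ i : ℤ, 0 ≤ i → i < n → x (p + i) = y (q + i) := by
  rw [win_eq_iff]
  constructor
  · intro h i hi hn
    lift i to ℕ using hi
    exact h i (by exact_mod_cast hn)
  · intro h i hi
    exact h i (by positivity) (by exact_mod_cast hi)

theorem tail_win (n : ℕ) (x : ℤ → A) (p : ℤ) : Fin.tail (win (n + 1) x p) = win n x (p + 1) := by
  funext i
  simp only [Fin.tail, win, Fin.val_succ]
  congr 1
  push_cast
  ring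

theorem init_win (n : ℕ) (x : ℤ → A) (p : ℤ) : Fin.init (win (n + 1) x p) = win n x p := by
  funext i
  simp [Fin.init, win]

/-- The words of length `n` that occur in the elements of `X`. -/
def lang (X : Set (ℤ → A)) (n : ℕ) : Set (Fin n → A) :=
  {w | ∃ x ∈ X, ∃ p, win n x p = w}

/-- The words of length `n` that can be extended to the left in at least two ways. -/
def leftSpecial (X : Set (ℤ → A)) (n : ℕ) : Set (Fin n → A) :=
  {w | ∃ x ∈ X, ∃ y ∈ X, ∃ p q, win n x p = w ∧ win n y q = w ∧ x (p - 1) ≠ y (q - 1)}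

/-- Deleting the first letter maps words of length `n + 1` onto words of length `n`, and left
special words have at least two preimages. -/
theorem ncard_leftSpecial_le [Finite A] (X : Set (ℤ → A)) (n : ℕ) :
    (lang X n).ncard + (leftSpecial X n).ncard ≤ (lang X (n + 1)).ncard := by
  refine ncard_add_ncard_le_of_fibers Fin.tail (Set.toFinite _) ?_ ?_
  · rintro _ ⟨x, hx, p, rfl⟩
    exact ⟨win (n + 1) x (p - 1), ⟨x, hx, _, rfl⟩, by rw [tail_win, sub_add_cancel]⟩
  · rintro _ ⟨x, hx, y, hy, p, q, rfl, hq, hne⟩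
    refine ⟨win (n + 1) x (p - 1), ⟨x, hx, _, rfl⟩, win (n + 1) y (q - 1), ⟨y, hy, _, rfl⟩,
      fun h => hne ?_, by rw [tail_win, sub_add_cancel], by rw [tail_win, sub_add_cancel, hq]⟩
    simpa using win_eq_iff.1 h 0 (Nat.succ_pos n)

theorem sum_ncard_leftSpecial_le [Finite A] (X : Set (ℤ → A)) (m t : ℕ) :
    (lang X m).ncard + ∑ l ∈ Finset.range t, (leftSpecial X (m + l)).ncard
      ≤ (lang X (m + t)).ncard := by
  induction t with
  | zero => simp
  | succ t ih =>
    rw [Finset.sum_range_succ]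
    have := ncard_leftSpecial_le X (m + t)
    rw [← add_assoc m t 1]
    omega

/-! ### Periodic sequences -/

/-- A sequence in which each window of a fixed length determines the next letter is periodic. -/
theorem exists_period_of_determined [Finite A] {x : ℤ → A} (W : ℕ)
    (h : ∀ m n : ℤ, win W x m = win W x n → x (m + W) = x (n + W)) :
    ∃ d : ℕ, 0 < d ∧ ∀ i : ℤ, x (i + d) = x i := by
  have hstep : ∀ m n : ℤ, win W x m = win W x n → win W x (m + 1) = win W x (n + 1) := by
    intro m n hmn
    rw [win_eq_iff] at hmn ⊢
    intro i hi
    rcases Nat.lt_or_ge (i + 1) W with hi' | hi'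
    · have := hmn (i + 1) hi'
      push_cast at this
      convert this using 2 <;> ring
    · have hW : W = i + 1 := by omega
      have := h m n (win_eq_iff.2 hmn)
      subst hW
      push_cast at this
      convert this using 2 <;> ring
  have hfwd : ∀ m n : ℤ, win W x m = win W x n → ∀ j : ℕ, win W x (m + j) = win W x (n + j) := by
    intro m n hmn j
    induction j with
    | zero => simpa using hmn
    | succ j ih =>
      have := hstep _ _ ih
      push_cast
      rwa [← add_assoc, ← add_assoc]
  set N := Nat.card (Fin W → A) with hN
  -- Pigeonhole gives, for each `i`, a period at most `N` valid to the right of `i`; it may depend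
  -- on `i`, but always divides `N!`.
  refine ⟨N.factorial, Nat.factorial_pos N, fun i => ?_⟩
  obtain ⟨a, b, hab, hw⟩ : ∃ a b : Fin (N + 1), a ≠ b ∧
      win W x (i - N - W + a) = win W x (i - N - W + b) := by
    have : ¬ Function.Injective fun a : Fin (N + 1) => win W x (i - N - W + (a : ℕ)) := by
      intro hinj
      have := Nat.card_le_card_of_injective _ hinj
      simp only [Nat.card_eq_fintype_card, Fintype.card_fin] at this
      omega
    simp only [Function.Injective, not_forall] at this
    obtain ⟨a, b, h1, h2⟩ := this
    exact ⟨a, b, h2, h1⟩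
  wlog hlt : a < b generalizing a b
  · exact this b a hab.symm hw.symm (lt_of_le_of_ne (not_lt.1 hlt) hab.symm)
  have hab' : (a : ℕ) < b := hlt
  have ha := a.2
  have hb := b.2
  obtain ⟨d, hd⟩ : ∃ d : ℕ, (b : ℕ) = a + d := ⟨b - a, by omega⟩
  have hper : ∀ j : ℤ, i ≤ j → x (j + d) = x j := by
    intro j hj
    obtain ⟨e, he⟩ := Int.eq_ofNat_of_zero_le (a := j - W - (i - N - W + (a : ℕ))) (by omega)
    have h1 := h _ _ (hfwd _ _ hw e)
    have e1 : i - N - W + ((a : ℕ) : ℤ) + e + W = j := by omega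
    have e2 : i - N - W + ((b : ℕ) : ℤ) + e + W = j + d := by rw [hd]; push_cast; omega
    rw [e1, e2] at h1
    exact h1.symm
  have hmul : ∀ c : ℕ, x (i + (d * c : ℕ)) = x i := by
    intro c
    induction c with
    | zero => simp
    | succ c ih =>
      rw [← ih, ← hper (i + (d * c : ℕ)) (by omega)]
      congr 1
      push_cast
      ring
  obtain ⟨c, hc⟩ : d ∣ N.factorial := Nat.dvd_factorial (by omega) (by omega)
  rw [hc]
  exact hmul c

/-- The words of length `n` of `x` in which the word of length `l` at `c` occurs. -/
def wordsThrough (x : ℤ → A) (c : ℤ) (l n : ℕ) : Set (Fin n → A) :=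
  {u | ∃ p : ℤ, (∃ j : ℕ, j + l ≤ n ∧ win l x (p + j) = win l x c) ∧ win n x p = u}

/-- Without strict growth, deleting the last or the first letter never loses the marked word.
Sliding left and right from `c` then shows that every window contains it, and injectivity of
`Fin.init` makes each window determine the next letter, so `x` would be periodic. -/
theorem ncard_wordsThrough_lt [Finite A] {x : ℤ → A} {c : ℤ} {l n : ℕ} (hn : l ≤ n)
    (hx : ¬ ∃ d : ℕ, 0 < d ∧ ∀ i : ℤ, x (i + d) = x i) :
    (wordsThrough x c l n).ncard < (wordsThrough x c l (n + 1)).ncard := by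
  by_contra! hle
  have hocc : ∀ p, win n x p ∈ wordsThrough x c l n →
      ∃ j : ℕ, j + l ≤ n ∧ win l x (p + j) = win l x c := by
    rintro p ⟨q, ⟨j, hj, hjw⟩, hq⟩
    refine ⟨j, hj, hjw ▸ ?_⟩
    rw [win_eq_iff] at hq ⊢
    intro i hi
    have := hq (j + i) (by omega)
    push_cast at this
    rw [add_assoc, add_assoc]
    exact this.symm
  have hright : ∀ p, win n x p ∈ wordsThrough x c l n →
      win (n + 1) x p ∈ wordsThrough x c l (n + 1) := by
    intro p hp
    obtain ⟨j, hj, hjw⟩ := hocc p hp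
    exact ⟨p, ⟨j, by omega, hjw⟩, rfl⟩
  have hleft : ∀ p, win n x p ∈ wordsThrough x c l n →
      win (n + 1) x (p - 1) ∈ wordsThrough x c l (n + 1) := by
    intro p hp
    obtain ⟨j, hj, hjw⟩ := hocc p hp
    refine ⟨p - 1, ⟨j + 1, by omega, ?_⟩, rfl⟩
    rw [← hjw]
    congr 1
    push_cast
    ring
  obtain ⟨hinit, hinj⟩ := mapsTo_and_injOn_of_ncard_le (S := wordsThrough x c l (n + 1))
    (T := wordsThrough x c l n) Fin.init (Set.toFinite _) (by
      rintro u hu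
      obtain ⟨p, hp, rfl⟩ := id hu
      exact ⟨_, hright p hu, init_win n x p⟩) hle
  obtain ⟨htail, -⟩ := mapsTo_and_injOn_of_ncard_le (S := wordsThrough x c l (n + 1))
    (T := wordsThrough x c l n) Fin.tail (Set.toFinite _) (by
      rintro u hu
      obtain ⟨p, hp, rfl⟩ := id hu
      exact ⟨_, hleft p hu, by rw [tail_win, sub_add_cancel]⟩) hle
  have hall : ∀ t : ℤ, win n x (c + t) ∈ wordsThrough x c l n := by
    intro t
    induction t using Int.induction_on with
    | zero => exact ⟨c, ⟨0, by omega, by simp⟩, by simp⟩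
    | succ i ih =>
      have := htail (hright _ ih)
      rwa [tail_win, add_assoc] at this
    | pred i ih =>
      have := hinit (hleft _ ih)
      rwa [init_win, add_sub_assoc] at this
  have hall' : ∀ p : ℤ, win n x p ∈ wordsThrough x c l n := fun p => by
    simpa using hall (p - c)
  refine hx (exists_period_of_determined n fun p q hpq => ?_)
  have := hinj (hright p (hall' p)) (hright q (hall' q)) (by rw [init_win, init_win, hpq])
  exact win_eq_iff.1 this n (Nat.lt_succ_self n)

theorem le_ncard_wordsThrough [Finite A] {x : ℤ → A} (c : ℤ) (l n : ℕ)
    (hx : ¬ ∃ d : ℕ, 0 < d ∧ ∀ i : ℤ, x (i + d) = x i) :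
    n ≤ (wordsThrough x c l n).ncard + l := by
  induction n with
  | zero => omega
  | succ n ih =>
    rcases Nat.lt_or_ge n l with h | h
    · omega
    · have := ncard_wordsThrough_lt (c := c) h hx
      omega

/-! ### Reflection -/

/-- The reflected sequence `i ↦ x (-i)`. -/
def reflect (x : ℤ → A) : ℤ → A := fun i => x (-i)

@[simp] theorem reflect_reflect (x : ℤ → A) : reflect (reflect x) = x := by
  funext i
  simp [reflect]

theorem ncard_lang_reflect_le [Finite A] (X : Set (ℤ → A)) (n : ℕ) :
    (lang (reflect '' X) n).ncard ≤ (lang X n).ncard := by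
  refine (Set.ncard_le_ncard (t := (fun w : Fin n → A => w ∘ Fin.rev) '' lang X n) ?_
    (Set.toFinite _)).trans (Set.ncard_image_le (Set.toFinite _))
  rintro _ ⟨_, ⟨x, hx, rfl⟩, p, rfl⟩
  refine ⟨win n x (-p - n + 1), ⟨x, hx, _, rfl⟩, ?_⟩
  funext i
  simp only [Function.comp, win, reflect, Fin.val_rev]
  congr 1
  have := i.2
  omega

/-! ### Growth of sequences of linear growth -/

/-- Otherwise `P` would gain `4kT` at each step of length `T` from `d + N + 1` up to about `2d`,
exceeding `k n` at the end. -/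
theorem exists_small_increment {P : ℕ → ℕ} {k n₀ T N d : ℕ} (hk : 0 < k) (hT : 0 < T)
    (hP : ∀ n, n₀ ≤ n → P n ≤ k * n) (hd : 2 * N + 2 * T + n₀ + 1 ≤ d) :
    ∃ m, d + N + 1 ≤ m ∧ m + T ≤ 2 * d ∧ P (m + T) < P m + 4 * k * T := by
  by_contra! h
  set J := (d - N - 1) / T with hJ
  have hJT : J * T ≤ d - N - 1 := Nat.div_mul_le_self _ _
  have hJT' : d - N - 1 < J * T + T := by
    have := Nat.lt_div_mul_add (a := d - N - 1) hT
    rwa [← hJ] at this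
  have key : ∀ j, j ≤ J → j * (4 * k * T) ≤ P (d + N + 1 + j * T) := by
    intro j
    induction j with
    | zero => simp
    | succ j ih =>
      intro hj
      have h1 : (j + 1) * T ≤ J * T := Nat.mul_le_mul_right T hj
      have h2 := h (d + N + 1 + j * T) (by omega) (by rw [add_mul] at h1; omega)
      have h3 := ih (by omega)
      have e : d + N + 1 + (j + 1) * T = d + N + 1 + j * T + T := by ring
      rw [e, add_mul, one_mul]
      omega
  have h1 := key J le_rfl
  have h2 := hP (d + N + 1 + J * T) (by omega)
  have h3 : k * (4 * (J * T)) ≤ k * (d + N + 1 + J * T) := by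
    calc k * (4 * (J * T)) = J * (4 * k * T) := by ring
      _ ≤ _ := h1.trans h2
  have h4 := Nat.le_of_mul_le_mul_left h3 hk
  omega

/-! ### Shift-commuting maps of finite range -/

/-- `f` maps `X` to itself and is given by a sliding block code of range `R` on `X`. -/
def IsBlockCode (X : Set (ℤ → A)) (R : ℕ) (f : (ℤ → A) → (ℤ → A)) : Prop :=
  (∀ x ∈ X, f x ∈ X) ∧ ∀ x ∈ X, ∀ y ∈ X, ∀ m n : ℤ,
    (∀ i : ℤ, -(R : ℤ) ≤ i → i ≤ R → x (m + i) = y (n + i)) → f x m = f y n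

/-- `f` and `g` are sliding block codes of range `R` that are mutually inverse on `X`. -/
structure IsBlockCodePair (X : Set (ℤ → A)) (R : ℕ) (f g : (ℤ → A) → (ℤ → A)) : Prop where
  left : IsBlockCode X R f
  right : IsBlockCode X R g
  left_inv : ∀ x ∈ X, g (f x) = x
  right_inv : ∀ x ∈ X, f (g x) = x

/-- The images of `x` under the invertible sliding block codes of range `R` on `X`. -/
def images (X : Set (ℤ → A)) (R : ℕ) (x : ℤ → A) : Set (ℤ → A) :=
  {y | ∃ f g, IsBlockCodePair X R f g ∧ f x = y}

theorem IsBlockCodePair.symm {X : Set (ℤ → A)} {R : ℕ} {f g : (ℤ → A) → (ℤ → A)}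
    (h : IsBlockCodePair X R f g) : IsBlockCodePair X R g f :=
  ⟨h.right, h.left, h.right_inv, h.left_inv⟩

theorem IsBlockCode.eq_at {X : Set (ℤ → A)} {R : ℕ} {f : (ℤ → A) → (ℤ → A)}
    (h : IsBlockCode X R f) {x y : ℤ → A} (hx : x ∈ X) (hy : y ∈ X) (n : ℤ)
    (hxy : ∀ i, n - R ≤ i → i ≤ n + R → x i = y i) : f x n = f y n :=
  h.2 x hx y hy n n fun i h1 h2 => hxy _ (by omega) (by omega)

theorem IsBlockCode.reflect {X : Set (ℤ → A)} {R : ℕ} {f : (ℤ → A) → (ℤ → A)}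
    (h : IsBlockCode X R f) :
    IsBlockCode (reflect '' X) R fun x => reflect (f (reflect x)) := by
  constructor
  · rintro _ ⟨x, hx, rfl⟩
    exact ⟨f x, h.1 x hx, by simp⟩
  · rintro _ ⟨x, hx, rfl⟩ _ ⟨y, hy, rfl⟩ m n hmn
    simp only [reflect_reflect]
    refine h.2 x hx y hy (-m) (-n) fun i h1 h2 => ?_
    have := hmn (-i) (by omega) (by omega)
    simp only [ShiftSystem.reflect] at this
    convert this using 2 <;> ring

theorem IsBlockCodePair.reflect {X : Set (ℤ → A)} {R : ℕ} {f g : (ℤ → A) → (ℤ → A)}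
    (h : IsBlockCodePair X R f g) :
    IsBlockCodePair (reflect '' X) R (fun x => ShiftSystem.reflect (f (ShiftSystem.reflect x)))
      (fun x => ShiftSystem.reflect (g (ShiftSystem.reflect x))) where
  left := h.left.reflect
  right := h.right.reflect
  left_inv := by
    rintro _ ⟨x, hx, rfl⟩
    simp [h.left_inv x hx]
  right_inv := by
    rintro _ ⟨x, hx, rfl⟩
    simp [h.right_inv x hx]

theorem encard_images_le_reflect (X : Set (ℤ → A)) (R : ℕ) (x : ℤ → A) :
    (images X R x).encard ≤ (images (reflect '' X) R (reflect x)).encard := by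
  have hinj : Function.Injective (reflect : (ℤ → A) → (ℤ → A)) :=
    Function.LeftInverse.injective reflect_reflect
  rw [← hinj.encard_image]
  refine Set.encard_le_encard ?_
  rintro _ ⟨_, ⟨f, g, hfg, rfl⟩, rfl⟩
  exact ⟨_, _, hfg.reflect, by simp⟩

/-- Every window of `x` of radius `R` occurs in a bounded part of `x`. -/
theorem exists_window_bound [Finite A] (x : ℤ → A) (R : ℕ) :
    ∃ N : ℕ, ∀ c : ℤ, ∃ c' : ℤ, -(N : ℤ) ≤ c' ∧ c' ≤ N ∧
      ∀ i : ℤ, -(R : ℤ) ≤ i → i ≤ R → x (c + i) = x (c' + i) := by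
  have hb : ∀ w : Fin (2 * R + 1) → A, ∃ b : ℕ, (∃ c, win (2 * R + 1) x (c - R) = w) →
      ∃ c' : ℤ, -(b : ℤ) ≤ c' ∧ c' ≤ b ∧ win (2 * R + 1) x (c' - R) = w := by
    intro w
    by_cases h : ∃ c, win (2 * R + 1) x (c - R) = w
    · obtain ⟨c, hc⟩ := h
      exact ⟨c.natAbs, fun _ => ⟨c, by omega, by omega, hc⟩⟩
    · exact ⟨0, fun h' => absurd h' h⟩
  choose b hb using hb
  obtain ⟨N, hN⟩ := (Set.finite_range b).bddAbove
  refine ⟨N, fun c => ?_⟩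
  obtain ⟨c', h1, h2, h3⟩ := hb _ ⟨c, rfl⟩
  have hbN : b (win (2 * R + 1) x (c - R)) ≤ N := hN ⟨_, rfl⟩
  refine ⟨c', by omega, by omega, fun i hi hi' => ?_⟩
  have := win_eq_iff_int.1 h3 (i + R) (by omega) (by push_cast; omega)
  rw [show c' + i = c' - R + (i + R) by ring, this]
  congr 1
  ring

/-- If `z ∈ X` agrees with `x` on a long interval to the right of a position where they differ,
then a left special word of `f x` of controlled length determines `f x`. -/
theorem encard_images_le_of_left [Finite A] {X : Set (ℤ → A)} {k n₀ N R d : ℕ} (hk : 0 < k)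
    (hX : ∀ n, n₀ ≤ n → (lang X n).ncard ≤ k * n) {x z : ℤ → A} (hx : x ∈ X) (hz : z ∈ X)
    (hN : ∀ c : ℤ, ∃ c' : ℤ, -(N : ℤ) ≤ c' ∧ c' ≤ N ∧
      ∀ i : ℤ, -(R : ℤ) ≤ i → i ≤ R → x (c + i) = x (c' + i))
    (hd : 2 * (N + R) + 2 * (2 * R + 1) + n₀ + 1 ≤ d)
    (hxz : ∀ i : ℤ, -(d : ℤ) < i → i < d → z i = x i) (hne : z (-d) ≠ x (-d)) :
    (images X R x).encard ≤ ((4 * k * (2 * R + 1) : ℕ) : ℕ∞) := by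
  obtain ⟨m, hm1, hm2, hm3⟩ := exists_small_increment (T := 2 * R + 1) hk (by omega) hX hd
  -- Common right end (exclusive) of all the words used. The word of length `m + l` starts just
  -- after `-d + R - l`, so `l ≤ 2R` covers every possible place of the last difference. The bounds
  -- on `m` give `N < e ≤ d - R`.
  set e : ℤ := -d + 1 + m + R with he
  have hcover : images X R x ⊆ ⋃ l ∈ Finset.range (2 * R + 1),
      {y ∈ images X R x | win (m + l) y (e - (m + l : ℕ)) ∈ leftSpecial X (m + l)} := by
    intro y hy
    obtain ⟨f, g, hfg, rfl⟩ := id hy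
    have hfx := hfg.left.1 x hx
    have hfz := hfg.left.1 z hz
    -- Agreement on this whole interval would be carried by `g` to agreement of `z` and `x` at `-d`.
    have hdiff : ∃ r : ℤ, -(d : ℤ) - R ≤ r ∧ r ≤ -d + R ∧ f z r ≠ f x r := by
      by_contra! h
      refine hne ?_
      rw [← hfg.left_inv z hz, ← hfg.left_inv x hx]
      exact hfg.right.eq_at hfz hfx _ fun i h1 h2 => h i h1 h2
    obtain ⟨r, ⟨hr1, hr2, hr3⟩, hmax⟩ := Int.exists_greatest_of_bdd
      (P := fun r : ℤ => -(d : ℤ) - R ≤ r ∧ r ≤ -d + R ∧ f z r ≠ f x r)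
      ⟨-d + R, fun r hr => hr.2.1⟩ hdiff
    obtain ⟨l, hl⟩ := Int.eq_ofNat_of_zero_le (a := e - 1 - r - m) (by omega)
    refine Set.mem_biUnion (x := l) (Finset.mem_coe.2 (Finset.mem_range.2 (by omega))) ⟨hy, ?_⟩
    refine ⟨f x, hfx, f z, hfz, _, e - (m + l : ℕ), rfl, ?_, ?_⟩
    · rw [win_eq_iff_int]
      intro i hi0 hi1
      by_cases hir : e - (m + l : ℕ) + i ≤ -d + R
      · by_contra hc
        have := hmax (e - (m + l : ℕ) + i) ⟨by push_cast; omega, hir, hc⟩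
        push_cast at this
        omega
      · push_cast at hir hi1
        exact hfg.left.eq_at hz hx _ fun j h1 h2 => hxz j (by push_cast at h1; omega)
          (by push_cast at h2; omega)
    · have : e - ((m + l : ℕ) : ℤ) - 1 = r := by push_cast; omega
      rw [this]
      exact hr3.symm
  have hinj : ∀ l ∈ Finset.range (2 * R + 1),
      {y ∈ images X R x | win (m + l) y (e - (m + l : ℕ)) ∈ leftSpecial X (m + l)}.encard
        ≤ ((leftSpecial X (m + l)).ncard : ℕ∞) := by
    intro l hl
    rw [(Set.toFinite (leftSpecial X (m + l))).cast_ncard_eq]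
    refine Set.encard_le_encard_of_injOn (f := fun y => win (m + l) y (e - (m + l : ℕ)))
      (fun y hy => hy.2) ?_
    rintro y ⟨⟨f, g, hf, rfl⟩, -⟩ y' ⟨⟨f', g', hf', rfl⟩, -⟩ hyy'
    funext c
    -- The position `c'` depends on `x` only, so every image of `x` has equal letters at `c` and
    -- `c'`, and `c'` lies inside the word.
    obtain ⟨c', h1, h2, h3⟩ := hN c
    rw [hf.left.2 x hx x hx c c' h3, hf'.left.2 x hx x hx c c' h3]
    have := win_eq_iff_int.1 hyy' (c' - (e - (m + l : ℕ))) (by push_cast; omega)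
      (by push_cast; omega)
    simpa using this
  have hsum := sum_ncard_leftSpecial_le X m (2 * R + 1)
  calc (images X R x).encard
      ≤ _ := Set.encard_le_encard hcover
    _ ≤ ∑ l ∈ Finset.range (2 * R + 1), _ := Finset.set_encard_biUnion_le _ _
    _ ≤ ∑ l ∈ Finset.range (2 * R + 1), ((leftSpecial X (m + l)).ncard : ℕ∞) :=
        Finset.sum_le_sum hinj
    _ ≤ _ := by
        rw [← Nat.cast_sum]
        exact_mod_cast (by omega)

/-- A point of `X` that is not isolated has at most linearly many images. -/
theorem encard_images_le_of_not_isolated [Finite A] {X : Set (ℤ → A)} {k n₀ : ℕ} (hk : 0 < k)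
    (hX : ∀ n, n₀ ≤ n → (lang X n).ncard ≤ k * n) {x : ℤ → A} (hx : x ∈ X)
    (hiso : ∀ N : ℕ, ∃ z ∈ X, z ≠ x ∧ ∀ i : ℤ, -(N : ℤ) ≤ i → i ≤ N → z i = x i) (R : ℕ) :
    (images X R x).encard ≤ ((8 * k * (R + 1) : ℕ) : ℕ∞) := by
  have hmono : ((4 * k * (2 * R + 1) : ℕ) : ℕ∞) ≤ ((8 * k * (R + 1) : ℕ) : ℕ∞) := by
    exact_mod_cast (by nlinarith)
  refine le_trans ?_ hmono
  obtain ⟨N, hN⟩ := exists_window_bound x R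
  obtain ⟨z, hz, hzx, hagree⟩ := hiso (2 * (N + R) + 2 * (2 * R + 1) + n₀ + 1)
  have hex : ∃ d : ℕ, z (-d) ≠ x (-d) ∨ z d ≠ x d := by
    by_contra! h
    refine hzx (funext fun i => ?_)
    rcases Int.natAbs_eq i with hi | hi
    · rw [hi]; exact (h _).2
    · rw [hi]; exact (h _).1
  classical
  have hspec := Nat.find_spec hex
  have hmin : ∀ e < Nat.find hex, z (-e) = x (-e) ∧ z e = x e := fun e he => by
    simpa using Nat.find_min hex he
  generalize Nat.find hex = d at hspec hmin
  have hlt : ∀ i : ℤ, -(d : ℤ) < i → i < d → z i = x i := by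
    intro i h1 h2
    rcases Int.natAbs_eq i with hi | hi
    · rw [hi]; exact (hmin _ (by omega)).2
    · rw [hi]; exact (hmin _ (by omega)).1
  have hd : 2 * (N + R) + 2 * (2 * R + 1) + n₀ + 1 ≤ d := by
    by_contra! hcon
    rcases hspec with h | h
    · exact h (hagree _ (by omega) (by omega))
    · exact h (hagree _ (by omega) (by omega))
  rcases hspec with h | h
  · exact encard_images_le_of_left hk hX hx hz hN hd hlt h
  · refine (encard_images_le_reflect X R x).trans (encard_images_le_of_left (z := reflect z)
      (N := N) (d := d) hk
      (fun n hn => (ncard_lang_reflect_le X n).trans (hX n hn)) ⟨x, hx, rfl⟩ ⟨z, hz, rfl⟩ ?_ hd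
      (fun i h1 h2 => hlt _ (by omega) (by omega)) (by simpa [reflect] using h))
    intro c
    obtain ⟨c', h1, h2, h3⟩ := hN (-c)
    refine ⟨-c', by omega, by omega, fun i hi hi' => ?_⟩
    have := h3 (-i) (by omega) (by omega)
    simp only [reflect]
    convert this using 2 <;> ring

/-- If `g` and `f'` have range `R` and `g (f' x)` is the translate of `x` by more than `2 * R`,
then `x` is periodic. -/
theorem exists_period_of_translate [Finite A] {X : Set (ℤ → A)} {R : ℕ}
    {f g f' g' : (ℤ → A) → (ℤ → A)} (h : IsBlockCodePair X R f g) (h' : IsBlockCodePair X R f' g')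
    {x : ℤ → A} (hx : x ∈ X) {J : ℕ} (hJ : 2 * R < J) (hfx : ∀ i, f' x i = f x (i + J)) :
    ∃ d : ℕ, 0 < d ∧ ∀ i : ℤ, x (i + d) = x i := by
  -- The letter `x (p + 2R + J)` equals `g (f' x) (p + 2R)`, which depends only on `x` over `[p, p +
  -- 4R]`; as `2R < J`, this interval lies strictly before that letter.
  refine exists_period_of_determined (2 * R + J) fun m n hmn => ?_
  have hwin : ∀ i : ℤ, -(2 * R : ℤ) ≤ i → i ≤ 2 * R → x (m + 2 * R + i) = x (n + 2 * R + i) := by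
    intro i h1 h2
    have := win_eq_iff_int.1 hmn (2 * R + i) (by omega) (by push_cast; omega)
    rw [add_assoc, add_assoc]
    exact this
  have key : ∀ p : ℤ, x (p + 2 * R + J) = g (f' x) (p + 2 * R) := by
    intro p
    conv_lhs => rw [← h.left_inv x hx]
    refine h.right.2 _ (h.left.1 x hx) _ (h'.left.1 x hx) _ _ fun i _ _ => ?_
    rw [hfx]
    congr 1
    ring
  have : g (f' x) (m + 2 * R) = g (f' x) (n + 2 * R) := by
    refine h.right.2 _ (h'.left.1 x hx) _ (h'.left.1 x hx) _ _ fun i h1 h2 => ?_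
    refine h'.left.2 x hx x hx _ _ fun j h3 h4 => ?_
    rw [add_assoc, add_assoc (n + 2 * (R : ℤ))]
    exact hwin _ (by omega) (by omega)
  rw [← key, ← key] at this
  push_cast
  rw [← add_assoc, ← add_assoc]
  exact this

/-- An isolated point of `X` that is not periodic has at most linearly many images. -/
theorem encard_images_le_of_isolated [Finite A] {X : Set (ℤ → A)} {s : Finset (ℤ → A)}
    (hs : ∀ z ∈ X, ∀ N : ℕ, ∃ y ∈ s, ∃ j : ℤ, (fun i => y (i + j)) ∈ X ∧
      ∀ i : ℤ, -(N : ℤ) ≤ i → i ≤ N → y (i + j) = z i)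
    {x : ℤ → A} (hx : x ∈ X) {N : ℕ}
    (hiso : ∀ z ∈ X, (∀ i : ℤ, -(N : ℤ) ≤ i → i ≤ N → z i = x i) → z = x)
    (hper : ¬ ∃ d : ℕ, 0 < d ∧ ∀ i : ℤ, x (i + d) = x i) (R : ℕ) :
    (images X R x).encard ≤ ((4 * s.card * (R + 1) : ℕ) : ℕ∞) := by
  classical
  -- A translate of some `y ∈ s` agreeing with `f x` on radius `N + R` is sent by `g` to a point
  -- agreeing with `x` on radius `N`, hence to `x`; so the translate is `f x`.
  have horb : ∀ z ∈ images X R x, ∃ y ∈ s, ∃ j : ℤ, ∀ i, z i = y (i + j) := by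
    rintro _ ⟨f, g, hfg, rfl⟩
    have hfx := hfg.left.1 x hx
    obtain ⟨y, hy, j, hyX, hj⟩ := hs _ hfx (N + R)
    refine ⟨y, hy, j, fun i => ?_⟩
    have h1 : g (fun i => y (i + j)) = x := by
      refine hiso _ (hfg.right.1 _ hyX) fun i hi hi' => ?_
      conv_rhs => rw [← hfg.left_inv x hx]
      exact hfg.right.eq_at hyX hfx _ fun l hl hl' => hj l (by push_cast; omega)
        (by push_cast; omega)
    rw [← h1, hfg.right_inv _ hyX]
  have hrep : ∀ y : ℤ → A, ∃ z : ℤ → A, (∃ w ∈ images X R x, ∃ j : ℤ, ∀ i, w i = y (i + j)) →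
      z ∈ images X R x ∧ ∃ j : ℤ, ∀ i, z i = y (i + j) := by
    intro y
    by_cases h : ∃ w ∈ images X R x, ∃ j : ℤ, ∀ i, w i = y (i + j)
    · obtain ⟨w, hw⟩ := h
      exact ⟨w, fun _ => hw⟩
    · exact ⟨y, fun h' => absurd h' h⟩
  choose rep hrep using hrep
  have hsub : images X R x ⊆ ((s ×ˢ Finset.Icc (-(2 * R : ℤ)) (2 * R)).image
      fun p i => rep p.1 (i + p.2) : Finset (ℤ → A)) := by
    intro z hz
    obtain ⟨y, hy, j, hj⟩ := horb z hz
    obtain ⟨hr, j', hj'⟩ := hrep y ⟨z, hz, j, hj⟩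
    have hz' : ∀ i, z i = rep y (i + (j - j')) := fun i => by
      rw [hj', hj]
      congr 1
      ring
    rw [Finset.coe_image]
    refine ⟨(y, j - j'), ?_, funext fun i => (hz' i).symm⟩
    simp only [Finset.mem_coe, Finset.mem_product, Finset.mem_Icc]
    obtain ⟨f, g, hfg, hf⟩ := hr
    obtain ⟨f', g', hfg', hf'⟩ := hz
    refine ⟨hy, ?_, ?_⟩
    · by_contra! hlt
      refine hper (exists_period_of_translate hfg' hfg hx (J := (j' - j).toNat) (by omega) ?_)
      intro i
      rw [hf, hf', hz']
      congr 1
      omega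
    · by_contra! hlt
      refine hper (exists_period_of_translate hfg hfg' hx (J := (j - j').toNat) (by omega) ?_)
      intro i
      rw [hf, hf', hz']
      congr 1
      omega
  refine (Set.encard_le_encard hsub).trans ?_
  rw [Set.encard_coe_eq_coe_finsetCard]
  have h1 : (s ×ˢ Finset.Icc (-(2 * R : ℤ)) (2 * R)).card = s.card * (4 * R + 1) := by
    rw [Finset.card_product, Int.card_Icc]
    congr 1
    omega
  exact_mod_cast Finset.card_image_le.trans (h1.le.trans (by nlinarith))

/-- The number of images of a periodic point does not depend on the range. -/
theorem encard_images_le_of_periodic [Finite A] {X : Set (ℤ → A)} {x : ℤ → A} (hx : x ∈ X)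
    {d : ℕ} (hd : 0 < d) (hper : ∀ i : ℤ, x (i + d) = x i) (R : ℕ) :
    (images X R x).encard ≤ (Nat.card (Fin d → A) : ℕ∞) := by
  have hdet : ∀ y ∈ images X R x, ∀ i : ℤ, y i = y (i % d) := by
    rintro _ ⟨f, g, hfg, rfl⟩ i
    have h1 : ∀ c : ℕ, ∀ j : ℤ, x (j + d * c) = x j := by
      intro c
      induction c with
      | zero => simp
      | succ c ih =>
        intro j
        rw [← ih j, ← hper (j + d * c)]
        congr 1
        push_cast
        ring
    have h2 : ∀ c j : ℤ, x (j + d * c) = x j := by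
      intro c j
      rcases Int.natAbs_eq c with hc | hc
      · rw [hc]; exact h1 _ j
      · rw [hc, ← h1 c.natAbs (j + d * -(c.natAbs : ℤ))]
        congr 1
        ring
    refine hfg.left.2 x hx x hx _ _ fun j _ _ => ?_
    rw [← h2 (i / d) (i % d + j)]
    congr 1
    linarith [Int.mul_ediv_add_emod i d]
  rw [← Set.ncard_univ, (Set.toFinite _).cast_ncard_eq]
  refine Set.encard_le_encard_of_injOn (f := fun y => win d y 0) (fun _ _ => Set.mem_univ _) ?_
  intro y hy y' hy' h
  funext i
  rw [hdet y hy, hdet y' hy']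
  have := win_eq_iff_int.1 h (i % d) (Int.emod_nonneg _ (by omega)) (Int.emod_lt_of_pos _ (by omega))
  simpa using this

theorem exists_encard_images_le [Finite A] {X : Set (ℤ → A)} {k n₀ : ℕ}
    (hX : ∀ n, n₀ ≤ n → (lang X n).ncard ≤ k * n) {s : Finset (ℤ → A)}
    (hs : ∀ z ∈ X, ∀ N : ℕ, ∃ y ∈ s, ∃ j : ℤ, (fun i => y (i + j)) ∈ X ∧
      ∀ i : ℤ, -(N : ℤ) ≤ i → i ≤ N → y (i + j) = z i) {x : ℤ → A} (hx : x ∈ X) :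
    ∃ C : ℕ, ∀ R : ℕ, (images X R x).encard ≤ ((C * (R + 1) : ℕ) : ℕ∞) := by
  by_cases hper : ∃ d : ℕ, 0 < d ∧ ∀ i : ℤ, x (i + d) = x i
  · obtain ⟨d, hd, hper⟩ := hper
    refine ⟨Nat.card (Fin d → A), fun R => (encard_images_le_of_periodic hx hd hper R).trans ?_⟩
    exact_mod_cast Nat.le_mul_of_pos_right _ (Nat.succ_pos R)
  by_cases hiso : ∃ N : ℕ, ∀ z ∈ X, (∀ i : ℤ, -(N : ℤ) ≤ i → i ≤ N → z i = x i) → z = x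
  · obtain ⟨N, hiso⟩ := hiso
    exact ⟨4 * s.card, encard_images_le_of_isolated hs hx hiso hper⟩
  · push Not at hiso
    -- `k + 1` replaces `k` because a positive slope is required.
    refine ⟨8 * (k + 1), encard_images_le_of_not_isolated (n₀ := n₀) (Nat.succ_pos k)
      (fun n hn => (hX n hn).trans (Nat.mul_le_mul_right n (Nat.le_succ k))) hx fun N => ?_⟩
    obtain ⟨z, hz, h1, h2⟩ := hiso N
    exact ⟨z, hz, h2, h1⟩

open SymbolicDynamics.FullShift

variable [TopologicalSpace A]

/-! ### Subshifts and their automorphisms -/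

section Basic

variable {X : Subshift A ℤ}

theorem sigma_pow_apply (n : ℕ) (x : X.carrier) (i : ℤ) :
    ((sigma X ^ n) x).1 i = x.1 (i + n) := by
  induction n generalizing x with
  | zero => simp
  | succ n ih =>
    rw [pow_succ, Homeomorph.mul_apply, ih]
    change x.1 (1 + (i + n)) = _
    refine congrArg x.1 ?_
    push_cast
    ring

theorem sigma_zpow_apply (n : ℤ) (x : X.carrier) (i : ℤ) :
    ((sigma X ^ n) x).1 i = x.1 (i + n) := by
  obtain ⟨m, rfl | rfl⟩ := n.eq_nat_or_neg
  · rw [zpow_natCast, sigma_pow_apply]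
  · have h := sigma_pow_apply m ((sigma X ^ (-(m : ℤ))) x) (i + -m)
    rw [← zpow_natCast, ← Homeomorph.mul_apply, ← zpow_add] at h
    simpa using h.symm

theorem IsAperiodic.not_periodic {x : X.carrier} (hx : IsAperiodic x) :
    ¬ ∃ d : ℕ, 0 < d ∧ ∀ i : ℤ, x.1 (i + d) = x.1 i := by
  rintro ⟨d, hd, h⟩
  refine hx d hd (Subtype.ext (funext fun i => ?_))
  rw [sigma_pow_apply, h]

theorem words_eq_lang (X : Subshift A ℤ) (n : ℕ) : words X n = lang X.carrier n := by
  ext w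
  constructor
  · rintro ⟨x, hx, hw⟩
    exact ⟨x, hx, 0, funext fun i => by simp [win, hw]⟩
  · rintro ⟨x, hx, p, rfl⟩
    exact ⟨shift p x, X.mapsTo p hx, fun i => rfl⟩

theorem exists_window_subset {U : Set X.carrier} (hU : IsOpen U) {x : X.carrier} (hx : x ∈ U) :
    ∃ N : ℕ, ∀ z : X.carrier, (∀ i : ℤ, -(N : ℤ) ≤ i → i ≤ N → z.1 i = x.1 i) → z ∈ U := by
  obtain ⟨V, hV, rfl⟩ := isOpen_induced_iff.1 hU
  obtain ⟨I, u, hu, hsub⟩ := isOpen_pi_iff.1 hV x.1 hx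
  refine ⟨I.sup Int.natAbs, fun z hz => hsub fun i hi => ?_⟩
  have : i.natAbs ≤ I.sup Int.natAbs := Finset.le_sup (f := Int.natAbs) hi
  rw [hz i (by omega) (by omega)]
  exact (hu i hi).2

variable [DiscreteTopology A]

theorem isOpen_window (x : X.carrier) (N : ℕ) :
    IsOpen {z : X.carrier | ∀ i : ℤ, -(N : ℤ) ≤ i → i ≤ N → z.1 i = x.1 i} := by
  convert (isOpen_cylinder (Finset.Icc (-(N : ℤ)) N) x.1).preimage continuous_subtype_val using 1
  ext z
  simp [cylinder]

theorem dense_orbits_iff (s : Finset X.carrier) :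
    Dense (⋃ x ∈ s, orbit x) ↔ ∀ z : X.carrier, ∀ N : ℕ, ∃ x ∈ s, ∃ j : ℤ,
      ∀ i : ℤ, -(N : ℤ) ≤ i → i ≤ N → x.1 (i + j) = z.1 i := by
  constructor
  · intro h z N
    obtain ⟨y, hy, hys⟩ := h.inter_open_nonempty _ (isOpen_window z N) ⟨z, fun _ _ _ => rfl⟩
    simp only [Set.mem_iUnion] at hys
    obtain ⟨x, hx, j, rfl⟩ := hys
    exact ⟨x, hx, j, fun i h1 h2 => by rw [← sigma_zpow_apply]; exact hy i h1 h2⟩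
  · intro h z
    rw [mem_closure_iff]
    intro U hU hz
    obtain ⟨N, hN⟩ := exists_window_subset hU hz
    obtain ⟨x, hx, j, hj⟩ := h z N
    refine ⟨(sigma X ^ j) x, hN _ fun i h1 h2 => by rw [sigma_zpow_apply, hj i h1 h2], ?_⟩
    simp only [Set.mem_iUnion]
    exact ⟨x, hx, j, rfl⟩

/-- Curtis–Hedlund–Lyndon: `x ↦ (φ x) 0` is locally constant on a compact space. -/
theorem exists_mem_autRange [Finite A] (φ : Aut X) : ∃ R : ℕ, φ ∈ autRange X R := by
  have : CompactSpace X.carrier := isCompact_iff_compactSpace.1 X.isClosed.isCompact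
  have hcont : Continuous fun x : X.carrier => (φ.1 x).1 0 :=
    (continuous_apply 0).comp (continuous_subtype_val.comp φ.1.continuous)
  have hloc : ∀ x : X.carrier, ∃ N : ℕ, ∀ z : X.carrier,
      (∀ i : ℤ, -(N : ℤ) ≤ i → i ≤ N → z.1 i = x.1 i) → (φ.1 z).1 0 = (φ.1 x).1 0 := fun x =>
    exists_window_subset ((isOpen_discrete {(φ.1 x).1 0}).preimage hcont) rfl
  choose N hN using hloc
  obtain ⟨t, ht⟩ := isCompact_univ.elim_finite_subcover
    (fun x : X.carrier => {z : X.carrier | ∀ i : ℤ, -(N x : ℤ) ≤ i → i ≤ N x → z.1 i = x.1 i})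
    (fun x => isOpen_window x (N x)) fun x _ => Set.mem_iUnion.2 ⟨x, fun _ _ _ => rfl⟩
  refine ⟨t.sup N, fun x y hxy => ?_⟩
  obtain ⟨c, hc⟩ := Set.mem_iUnion.1 (ht (Set.mem_univ x))
  obtain ⟨hct, hxc⟩ := Set.mem_iUnion.1 hc
  have hle : N c ≤ t.sup N := Finset.le_sup hct
  rw [hN c x hxc, hN c y fun i h1 h2 => ?_]
  rw [← hxc i h1 h2, hxy i (by omega) (by omega)]

end Basic

section Automorphisms

variable {X : Subshift A ℤ}

theorem Aut.apply_sigma_zpow (φ : Aut X) (n : ℤ) (x : X.carrier) :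
    φ.1 ((sigma X ^ n) x) = (sigma X ^ n) (φ.1 x) := by
  have h : Commute (sigma X) φ.1 := Subgroup.mem_centralizer_singleton_iff.1 φ.2 |>.symm
  have h2 := (h.zpow_left n).eq
  rw [← Homeomorph.mul_apply, ← Homeomorph.mul_apply, h2]

theorem apply_eq_of_mem_autRange {φ : Aut X} {R : ℕ} (hφ : φ ∈ autRange X R) (x y : X.carrier)
    (m n : ℤ) (h : ∀ i : ℤ, -(R : ℤ) ≤ i → i ≤ R → x.1 (m + i) = y.1 (n + i)) :
    (φ.1 x).1 m = (φ.1 y).1 n := by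
  have := hφ ((sigma X ^ m) x) ((sigma X ^ n) y) fun i h1 h2 => by
    rw [sigma_zpow_apply, sigma_zpow_apply, add_comm i, add_comm i, h i h1 h2]
  rw [Aut.apply_sigma_zpow, Aut.apply_sigma_zpow, sigma_zpow_apply, sigma_zpow_apply] at this
  simpa using this

theorem autRange_mono {R R' : ℕ} (h : R ≤ R') : autRange X R ⊆ autRange X R' :=
  fun _ hφ x y hxy => hφ x y fun n h1 h2 => hxy n (by omega) (by omega)

theorem one_mem_autRange : (1 : Aut X) ∈ autRange X 0 := fun _ _ hxy => hxy 0 le_rfl le_rfl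

theorem mul_mem_autRange {φ ψ : Aut X} {R R' : ℕ} (hφ : φ ∈ autRange X R)
    (hψ : ψ ∈ autRange X R') : φ * ψ ∈ autRange X (R + R') := by
  intro x y hxy
  refine hφ (ψ.1 x) (ψ.1 y) fun n h1 h2 => ?_
  exact apply_eq_of_mem_autRange hψ x y n n fun i h3 h4 =>
    hxy _ (by push_cast; omega) (by push_cast; omega)

/-- The automorphisms `φ` such that both `φ` and `φ⁻¹` have range `R`. -/
def autBall (X : Subshift A ℤ) (R : ℕ) : Set (Aut X) :=
  {φ | φ ∈ autRange X R ∧ φ⁻¹ ∈ autRange X R}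

theorem list_prod_mem_autBall {R : ℕ} {l : List (Aut X)} (hl : ∀ φ ∈ l, φ ∈ autBall X R) :
    l.prod ∈ autBall X (l.length * R) := by
  induction l with
  | nil => simpa [autBall] using one_mem_autRange
  | cons φ l ih =>
    have h1 := hl φ (by simp)
    have h2 := ih fun ψ hψ => hl ψ (by simp [hψ])
    refine ⟨?_, ?_⟩
    · rw [List.prod_cons, List.length_cons, add_mul, one_mul, add_comm]
      exact mul_mem_autRange h1.1 h2.1
    · rw [List.prod_cons, List.length_cons, add_mul, one_mul, mul_inv_rev]
      exact mul_mem_autRange h2.2 h1.2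

/-- The extension of an automorphism to all sequences by the identity. -/
noncomputable def extendAut (φ : Aut X) (x : ℤ → A) : ℤ → A :=
  open Classical in if h : x ∈ X.carrier then (φ.1 ⟨x, h⟩).1 else x

theorem extendAut_apply (φ : Aut X) (x : X.carrier) : extendAut φ x.1 = (φ.1 x).1 := by
  simp [extendAut, x.2]

theorem isBlockCode_extendAut {φ : Aut X} {R : ℕ} (hφ : φ ∈ autRange X R) :
    IsBlockCode X.carrier R (extendAut φ) := by
  constructor
  · intro x hx
    rw [extendAut_apply φ ⟨x, hx⟩]
    exact Subtype.coe_prop _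
  · intro x hx y hy m n h
    rw [extendAut_apply φ ⟨x, hx⟩, extendAut_apply φ ⟨y, hy⟩]
    exact apply_eq_of_mem_autRange hφ ⟨x, hx⟩ ⟨y, hy⟩ m n h

theorem isBlockCodePair_extendAut {φ : Aut X} {R : ℕ} (hφ : φ ∈ autBall X R) :
    IsBlockCodePair X.carrier R (extendAut φ) (extendAut φ⁻¹) where
  left := isBlockCode_extendAut hφ.1
  right := isBlockCode_extendAut hφ.2
  left_inv x hx := by
    rw [extendAut_apply φ ⟨x, hx⟩, extendAut_apply]
    exact congrArg Subtype.val (φ.1.symm_apply_apply ⟨x, hx⟩)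
  right_inv x hx := by
    rw [extendAut_apply φ⁻¹ ⟨x, hx⟩, extendAut_apply]
    exact congrArg Subtype.val (φ.1.apply_symm_apply ⟨x, hx⟩)

theorem apply_mem_images {φ : Aut X} {R : ℕ} (hφ : φ ∈ autBall X R) (x : X.carrier) :
    (φ.1 x).1 ∈ images X.carrier R x.1 :=
  ⟨_, _, isBlockCodePair_extendAut hφ, extendAut_apply φ x⟩

/-- An automorphism is determined by its values on points whose orbits are dense. -/
theorem Aut.eq_of_dense [DiscreteTopology A] {s : Finset X.carrier}
    (hs : Dense (⋃ x ∈ s, orbit x)) {φ ψ : Aut X} (h : ∀ x ∈ s, φ.1 x = ψ.1 x) : φ = ψ := by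
  refine Subtype.ext (Homeomorph.ext fun z => ?_)
  have hcl : IsClosed {z : X.carrier | φ.1 z = ψ.1 z} :=
    isClosed_eq φ.1.continuous ψ.1.continuous
  refine hcl.closure_subset_iff.2 ?_ (hs z)
  intro y hy
  simp only [Set.mem_iUnion] at hy
  obtain ⟨x, hx, j, rfl⟩ := hy
  simp only [Set.mem_ofPred_eq, Aut.apply_sigma_zpow, h x hx]

theorem exists_encard_autBall_le [Finite A] [DiscreteTopology A] {k n₀ : ℕ}
    (hX : ∀ n, n₀ ≤ n → complexity X n ≤ k * n) {s : Finset X.carrier}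
    (hs : Dense (⋃ x ∈ s, orbit x)) :
    ∃ C : ℕ, ∀ R : ℕ, (autBall X R).encard ≤ ((C * (R + 1) ^ s.card : ℕ) : ℕ∞) := by
  classical
  have hdense := (dense_orbits_iff s).1 hs
  have hC : ∀ x : X.carrier, ∃ C : ℕ, ∀ R : ℕ,
      (images X.carrier R x.1).encard ≤ ((C * (R + 1) : ℕ) : ℕ∞) := by
    intro x
    refine exists_encard_images_le (k := k) (n₀ := n₀) (s := s.image Subtype.val) ?_ ?_ x.2
    · intro n hn
      rw [← words_eq_lang]
      exact hX n hn
    · intro z hz N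
      obtain ⟨y, hy, j, hj⟩ := hdense ⟨z, hz⟩ N
      refine ⟨y.1, Finset.mem_image_of_mem _ hy, j, ?_, hj⟩
      rw [show (fun i => y.1 (i + j)) = ((sigma X ^ j) y).1 from
        funext fun i => (sigma_zpow_apply j y i).symm]
      exact Subtype.coe_prop _
  choose C hC using hC
  refine ⟨∏ x ∈ s, C x, fun R => ?_⟩
  have hfin : ∀ x : X.carrier, (images X.carrier R x.1).Finite := fun x =>
    Set.finite_of_encard_le_coe (hC x R)
  have hcard : ∀ x : X.carrier, (hfin x).toFinset.card ≤ C x * (R + 1) := fun x => by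
    have := hC x R
    rw [(hfin x).encard_eq_coe_toFinset_card] at this
    exact_mod_cast this
  have hle : (autBall X R).encard ≤
      ((Fintype.piFinset fun x : s => (hfin x.1).toFinset : Finset (s → ℤ → A)) :
        Set (s → ℤ → A)).encard := by
    refine Set.encard_le_encard_of_injOn (f := fun (φ : Aut X) (x : s) => (φ.1 x.1).1) ?_ ?_
    · intro φ hφ
      simp only [Finset.mem_coe, Fintype.mem_piFinset, Set.Finite.mem_toFinset]
      exact fun x => apply_mem_images hφ x.1
    · intro φ _ ψ _ h
      exact Aut.eq_of_dense hs fun x hx => Subtype.ext (congrFun h ⟨x, hx⟩)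
  refine hle.trans ?_
  rw [Set.encard_coe_eq_coe_finsetCard, Fintype.card_piFinset]
  have : ∏ x : s, (hfin x.1).toFinset.card ≤ (∏ x ∈ s, C x) * (R + 1) ^ s.card := by
    calc ∏ x : s, (hfin x.1).toFinset.card ≤ ∏ x : s, C x.1 * (R + 1) :=
          Finset.prod_le_prod' fun x _ => hcard x.1
      _ = ∏ x ∈ s, C x * (R + 1) := Finset.prod_coe_sort s fun x => C x * (R + 1)
      _ = _ := by rw [Finset.prod_mul_distrib, Finset.prod_const]
  exact_mod_cast this

/-- If the balls of automorphisms of bounded range grow polynomially, so does every finitely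
generated group of automorphisms. -/
theorem hasPolynomialGrowthAtMost_of_autBall [Finite A] [DiscreteTopology A] {q C : ℕ}
    (hC : ∀ R : ℕ, (autBall X R).encard ≤ ((C * (R + 1) ^ q : ℕ) : ℕ∞))
    {H : Subgroup (Aut X)} (hH : H.FG) {d : ℕ} (hqd : q ≤ d) : HasPolynomialGrowthAtMost H d := by
  refine ⟨(Group.fg_iff_subgroup_fg H).2 hH, fun S _ => ?_⟩
  choose r hr using fun φ : Aut X => exists_mem_autRange φ
  set R := S.sup fun a => max (r a.1) (r a.1⁻¹) with hR
  have hgen : ∀ a : H, a ∈ S ∨ a⁻¹ ∈ S → a.1 ∈ autBall X R := by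
    have h1 : ∀ a ∈ S, a.1 ∈ autBall X R := by
      intro a ha
      have hle : max (r a.1) (r a.1⁻¹) ≤ R :=
        Finset.le_sup (f := fun a : H => max (r a.1) (r a.1⁻¹)) ha
      exact ⟨autRange_mono ((le_max_left _ _).trans hle) (hr _),
        autRange_mono ((le_max_right _ _).trans hle) (hr _)⟩
    rintro a (ha | ha)
    · exact h1 a ha
    · have := h1 _ ha
      exact ⟨by simpa using this.2, by simpa using this.1⟩
  -- The constant comes from `n R + 1 ≤ (R + 1) n`, valid for `n ≥ 1`.
  refine ⟨C * (R + 1) ^ q, fun n hn => ?_⟩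
  have hle : (wordBall S n).encard ≤ (autBall X (n * R)).encard := by
    refine Set.encard_le_encard_of_injOn (f := Subtype.val) ?_ Subtype.val_injective.injOn
    rintro _ ⟨l, hl, hlS, rfl⟩
    have h1 : (l.map Subtype.val).prod ∈ autBall X ((l.map Subtype.val).length * R) := by
      refine list_prod_mem_autBall fun φ hφ => ?_
      obtain ⟨a, ha, rfl⟩ := List.mem_map.1 hφ
      exact hgen a (hlS a ha)
    have h2 : (l.prod).1 = (l.map Subtype.val).prod := map_list_prod H.subtype l
    rw [h2]
    have h3 : (l.map Subtype.val).length * R ≤ n * R := by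
      rw [List.length_map]
      exact Nat.mul_le_mul_right R hl
    exact ⟨autRange_mono h3 h1.1, autRange_mono h3 h1.2⟩
  refine hle.trans ((hC _).trans ?_)
  have h1 : C * (n * R + 1) ^ q ≤ C * (R + 1) ^ q * n ^ d := by
    rw [mul_assoc]
    refine Nat.mul_le_mul_left C ?_
    calc (n * R + 1) ^ q ≤ ((R + 1) * n) ^ q := Nat.pow_le_pow_left (by nlinarith) q
      _ = (R + 1) ^ q * n ^ q := mul_pow _ _ _
      _ ≤ _ := Nat.mul_le_mul_left _ (Nat.pow_le_pow_right hn hqd)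
  exact_mod_cast h1

end Automorphisms

/-! ### Dense unions of orbits -/

section DenseOrbits

variable [Finite A] [DiscreteTopology A] {X : Subshift A ℤ}

/-- Fewer than `k` orbits miss some cylinder, which contains an aperiodic point `y`. The words of
`y` through the central block of that cylinder are new, and by `le_ncard_wordsThrough` there are at
least `n - (2N + 1)` of them. -/
theorem exists_le_ncard_lang_orbits (hX : Dense {x : X.carrier | IsAperiodic x}) {k : ℕ}
    (hk : ∀ s : Finset X.carrier, s.card < k → ¬ Dense (⋃ x ∈ s, orbit x)) :
    ∀ i ≤ k, ∃ s : Finset X.carrier, s.card ≤ i ∧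
      ∃ c : ℕ, ∀ n, i * n ≤ (lang (Subtype.val '' (s : Set X.carrier)) n).ncard + c := by
  classical
  intro i
  induction i with
  | zero => exact fun _ => ⟨∅, by simp, 0, by simp⟩
  | succ i ih =>
    intro hi
    obtain ⟨s, hs, c, hc⟩ := ih (by omega)
    have hnd := hk s (by omega)
    obtain ⟨z, N, hz⟩ : ∃ z : X.carrier, ∃ N : ℕ, ∀ x ∈ s, ∀ j : ℤ,
        ¬ ∀ i : ℤ, -(N : ℤ) ≤ i → i ≤ N → x.1 (i + j) = z.1 i := by
      rw [dense_orbits_iff] at hnd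
      push Not at hnd ⊢
      exact hnd
    obtain ⟨y, hyz, hy⟩ := hX.inter_open_nonempty _ (isOpen_window z N) ⟨z, fun _ _ _ => rfl⟩
    refine ⟨insert y s, (Finset.card_insert_le _ _).trans (by omega), c + (2 * N + 1),
      fun n => ?_⟩
    have hthrough := le_ncard_wordsThrough (-(N : ℤ)) (2 * N + 1) n hy.not_periodic
    have hdisj : Disjoint (lang (Subtype.val '' (s : Set X.carrier)) n)
        (wordsThrough y.1 (-(N : ℤ)) (2 * N + 1) n) := by
      rw [Set.disjoint_left]
      rintro _ ⟨_, ⟨x, hx, rfl⟩, p, rfl⟩ ⟨q, ⟨j, hj, hjw⟩, hqp⟩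
      refine hz x hx (p + j + N) fun i h1 h2 => ?_
      rw [← hyz i h1 h2]
      have e1 := win_eq_iff_int.1 hqp (j + (N + i)) (by omega) (by omega)
      have e2 := win_eq_iff_int.1 hjw (N + i) (by omega) (by push_cast; omega)
      rw [show i + (p + j + N) = p + (j + (N + i)) by ring, ← e1,
        show q + (j + (N + i)) = q + j + (N + i) by ring, e2]
      exact congrArg y.1 (by ring)
    have hsub : lang (Subtype.val '' (s : Set X.carrier)) n ∪
        wordsThrough y.1 (-(N : ℤ)) (2 * N + 1) n ⊆
        lang (Subtype.val '' ((insert y s : Finset X.carrier) : Set X.carrier)) n := by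
      rintro w (⟨_, ⟨x, hx, rfl⟩, p, rfl⟩ | ⟨p, -, rfl⟩)
      · exact ⟨x.1, ⟨x, by simp [Finset.mem_coe.1 hx], rfl⟩, p, rfl⟩
      · exact ⟨y.1, ⟨y, by simp, rfl⟩, p, rfl⟩
    have hcard := Set.ncard_le_ncard hsub (Set.toFinite _)
    rw [Set.ncard_union_eq hdisj (Set.toFinite _) (Set.toFinite _)] at hcard
    have := hc n
    rw [add_mul, one_mul]
    omega

theorem exists_dense_orbits (hX : Dense {x : X.carrier | IsAperiodic x}) {k : ℕ}
    (hk : limsup (fun n : ℕ => (complexity X n : ℝ≥0∞) / (n : ℝ≥0∞)) atTop < (k : ℝ≥0∞)) :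
    ∃ s : Finset X.carrier, s.card < k ∧ Dense (⋃ x ∈ s, orbit x) := by
  by_contra! hcon
  obtain ⟨s, -, c, hc⟩ := exists_le_ncard_lang_orbits hX hcon k le_rfl
  have hle : ∀ n, k * n ≤ complexity X n + c := fun n => (hc n).trans <| by
    refine Nat.add_le_add_right ?_ c
    rw [complexity, words_eq_lang]
    refine Set.ncard_le_ncard ?_ (Set.toFinite _)
    rintro _ ⟨_, ⟨x, -, rfl⟩, p, rfl⟩
    exact ⟨x.1, x.2, p, rfl⟩
  -- With `b` strictly between the limsup and `k`, the gap `(k - b) n` eventually exceeds `c`.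
  obtain ⟨b, hb1, hb2⟩ := ENNReal.lt_iff_exists_nnreal_btwn.1 hk
  have hbk : (b : ℝ) < k := by exact_mod_cast hb2
  have hev := eventually_lt_of_limsup_lt hb1
  obtain ⟨n, hn, hn0, hnc⟩ := (hev.and ((eventually_gt_atTop 0).and
    (eventually_gt_atTop ⌈(c : ℝ) / (k - b)⌉₊))).exists
  have h1 : (complexity X n : ℝ) ≤ b * n := by
    have h2 := (ENNReal.div_le_iff (by simpa using hn0.ne') (by simp)).1 hn.le
    have h3 : ((complexity X n : NNReal) : ℝ≥0∞) ≤ ((b * n : NNReal) : ℝ≥0∞) := by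
      push_cast
      exact h2
    exact_mod_cast ENNReal.coe_le_coe.1 h3
  have h2 : (k * n : ℝ) ≤ complexity X n + c := by exact_mod_cast hle n
  have h3 : (c : ℝ) / (k - b) < n := (Nat.le_ceil _).trans_lt (by exact_mod_cast hnc)
  rw [div_lt_iff₀ (by linarith)] at h3
  nlinarith

end DenseOrbits

theorem exists_complexity_le {X : Subshift A ℤ} {k : ℕ}
    (hk : limsup (fun n : ℕ => (complexity X n : ℝ≥0∞) / (n : ℝ≥0∞)) atTop < (k : ℝ≥0∞)) :
    ∃ n₀, ∀ n, n₀ ≤ n → complexity X n ≤ k * n := by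
  obtain ⟨n₀, hn₀⟩ := eventually_atTop.1 (eventually_lt_of_limsup_lt hk)
  refine ⟨n₀ + 1, fun n hn => ?_⟩
  have h := (ENNReal.div_le_iff (by simpa using (by omega : n ≠ 0)) (by simp)).1
    (hn₀ n (by omega)).le
  exact_mod_cast h

end ShiftSystem

open ShiftSystem in
theorem mainTheorem5 {A : Type*} [Finite A] [TopologicalSpace A] [DiscreteTopology A]
    (X : SymbolicDynamics.FullShift.Subshift A ℤ)
    (hX : Dense {x : X.carrier | ShiftSystem.IsAperiodic x})
    (k : ℕ)
    (hk : limsup (fun n : ℕ => (ShiftSystem.complexity X n : ℝ≥0∞) / (n : ℝ≥0∞)) atTop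
      < (k : ℝ≥0∞)) :
    (∀ H : Subgroup (ShiftSystem.Aut X), H.FG →
      ShiftSystem.HasPolynomialGrowthAtMost H (k - 1)) ∧
    ∃ q : ℕ, IsLeast (ShiftSystem.denseOrbitCounts X) q ∧ q ≤ k - 1 ∧
      (∀ H : Subgroup (ShiftSystem.Aut X), H.FG →
        ShiftSystem.HasPolynomialGrowthAtMost H q) ∧
      ∃ C : ℕ, ∀ R : ℕ,
        {φ : ShiftSystem.Aut X |
            φ ∈ ShiftSystem.autRange X R ∧ φ⁻¹ ∈ ShiftSystem.autRange X R}.encard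
          ≤ ((C * (R + 1) ^ q : ℕ) : ℕ∞) := by
  classical
  obtain ⟨t, htk, ht⟩ := exists_dense_orbits hX hk
  have hex : ∃ m, m ∈ denseOrbitCounts X := ⟨_, t, rfl, ht⟩
  have hqt : Nat.find hex ≤ t.card := Nat.find_le ⟨t, rfl, ht⟩
  obtain ⟨s, hs, hsd⟩ := Nat.find_spec hex
  obtain ⟨n₀, hn₀⟩ := exists_complexity_le hk
  obtain ⟨C, hC⟩ := exists_encard_autBall_le hn₀ hsd
  rw [hs] at hC
  exact ⟨fun H hH => hasPolynomialGrowthAtMost_of_autBall hC hH (by omega), Nat.find hex,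
    ⟨Nat.find_spec hex, fun m hm => Nat.find_le hm⟩, by omega,
    fun H hH => hasPolynomialGrowthAtMost_of_autBall hC hH le_rfl, C, hC⟩
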